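/- Let $\Gamma$ be a finite simple graph with vertex set $V$, and let $A_\Gamma = \langle V \mid ab = ba \text{ whenever } a, b \in V \text{ are adjacent in } \Gamma\rangle$ be the associated right-angled Artin group. Let $X = V \cup V^{-1}$ be its standard (inverse-closed) generating set, equipped with an arbitrary total order, and let $X^*$ be the set of words over $X$ with the induced shortlex order. Let the spherical conjugacy language $\mathsf{ConjSL}(A_\Gamma, X) \subseteq X^*$ be the set of all words $z_c$, where $c$ ranges over the conjugacy classes of $A_\Gamma$ and $z_c$ is the shortlex-least word over $X$ that represents an element of $c$. If $A_\Gamma$ is not free abelian, then $\mathsf{ConjSL}(A_\Gamma, X)$ is not a context-free language. -/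

import Mathlib

universe u

/-- The defining relators of the right-angled Artin group of `Γ`: the commutators `a b a⁻¹ b⁻¹` of
the pairs of adjacent vertices. -/
def raagRelators {V : Type u} (Γ : SimpleGraph V) : Set (FreeGroup V) :=
  {g | ∃ a b : V, Γ.Adj a b ∧
    g = FreeGroup.of a * FreeGroup.of b * (FreeGroup.of a)⁻¹ * (FreeGroup.of b)⁻¹}

/-- The right-angled Artin group `A_Γ`: one generator for each vertex, and two generators commute
when their vertices are adjacent. -/
abbrev RAAG {V : Type u} (Γ : SimpleGraph V) : Type u :=
  PresentedGroup (raagRelators Γ)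

/-- The group element that a letter of the standard generating set `V ∪ V⁻¹` stands for:
`(v, true)` is the letter `v` and `(v, false)` is the letter `v⁻¹`. -/
def raagLetter {V : Type u} (Γ : SimpleGraph V) (x : V × Bool) : RAAG Γ :=
  if x.2 then PresentedGroup.of x.1 else (PresentedGroup.of x.1)⁻¹

/-- The group element represented by a word over an alphabet `X` whose letters stand for elements
of a group. -/
def wordEval {X : Type*} {G : Type*} [Group G] (ev : X → G) (w : List X) : G :=
  (w.map ev).prod

/-- `w` is the shortlex conjugacy normal form of the conjugacy class `c`: it is the least word, in
the shortlex order induced by the strict order `lt` on the letters, that represents an element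
of `c`. -/
def IsShortlexConjNormalForm {X : Type*} {G : Type*} [Group G] (ev : X → G) (lt : X → X → Prop)
    (c : ConjClasses G) (w : List X) : Prop :=
  ConjClasses.mk (wordEval ev w) = c ∧
    ∀ w' : List X, ConjClasses.mk (wordEval ev w') = c → w = w' ∨ List.Shortlex lt w w'

/-- The spherical conjugacy language `ConjSL(G, X)`: the set of the shortlex conjugacy normal forms
of all conjugacy classes of `G`. -/
def conjSL {X : Type*} {G : Type*} [Group G] (ev : X → G) (lt : X → X → Prop) : Language X :=
  {w | ∃ c : ConjClasses G, IsShortlexConjNormalForm ev lt c w}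

/-- `G` is free abelian: it is isomorphic to the free abelian group on some set. -/
def IsFreeAbelian (G : Type u) [Group G] : Prop :=
  ∃ ι : Type u, Nonempty (G ≃* Multiplicative (FreeAbelianGroup ι))

/-!
A graph that is not complete has two distinct vertices that are not adjacent, and they can be named
`a` and `b` so that the letter `a` precedes the letter `b` in the given order. If there are no such
vertices, then `A_Γ` is free abelian (`isFreeAbelian_raag_of_forall_adj`).

Killing all the other generators retracts `A_Γ` to the free group on `a` and `b`. Together with the
exponent sum this shows that a word conjugate to a positive word `u` in `a` and `b` is longer than
`u` unless it is itself a positive word in `a` and `b`, and in a free group conjugate positive words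
are rotations of one another (`isRotated_of_conj_positiveWord`). Hence `u` belongs to the spherical
conjugacy language as soon as it is the least of its rotations (`positiveWord_mem_conjSL`), while
every word of the language is the least of its rotations (`not_lex_rotation_of_mem_conjSL`).

In particular `aⁿ bⁿ aⁿ bⁿ` belongs to the language for every `n`. The pumping lemma for
context-free languages (`Language.IsContextFree.pumping_lemma`) applied to this word for large `n`
leads to a
word that is not the least of its rotations (`false_of_pump_four_runs`), because the pumped factors
are too short to meet more than two of the four runs. A word `aᵖ b^q aʳ bˢ` of the language has
`p > r`, or `p = r` and `q ≤ s`, and removing or doubling the pumped factors violates this. If a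
pumped factor contains the border of two runs and removing it does no harm, then doubling it creates
a run that is too short for the result to be the least of its rotations.
-/

/-! ### The pumping lemma for context-free languages -/

namespace ContextFreeGrammar

variable {T : Type*} {g : ContextFreeGrammar T}

/-- `g.Yields s w n`: the sentential form `s` derives the terminal word `w` by a parse forest with
exactly `n` inner nodes. The number of inner nodes is recorded in order to speak of a smallest parse
tree of a word. -/
inductive Yields (g : ContextFreeGrammar T) : List (Symbol T g.NT) → List T → ℕ → Prop
  | nil : Yields g [] [] 0
  | terminal (t : T) {s : List (Symbol T g.NT)} {w : List T} {n : ℕ} (h : Yields g s w n) :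
      Yields g (.terminal t :: s) (t :: w) n
  | node {r : ContextFreeRule T g.NT} (hr : r ∈ g.rules) {s : List (Symbol T g.NT)}
      {w₁ w₂ : List T} {m n : ℕ} (h₁ : Yields g r.output w₁ m) (h₂ : Yields g s w₂ n) :
      Yields g (.nonterminal r.input :: s) (w₁ ++ w₂) (m + n + 1)

lemma Yields.derives {s : List (Symbol T g.NT)} {w : List T} {n : ℕ} (h : g.Yields s w n) :
    g.Derives s (w.map .terminal) := by
  induction h with
  | nil => exact .refl _
  | terminal t _ ih => simpa using ih.append_left [.terminal t]
  | @node r hr s w₁ w₂ m n _ _ ih₁ ih₂ =>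
    have h₁ : g.Produces (.nonterminal r.input :: s) (r.output ++ s) := ⟨r, hr, .head s⟩
    rw [List.map_append]
    exact h₁.trans_derives ((ih₁.append_right s).trans (ih₂.append_left _))

lemma yields_map_terminal (w : List T) : g.Yields (w.map .terminal) w 0 := by
  induction w with
  | nil => exact .nil
  | cons t w ih => exact .terminal t ih

lemma Yields.append {s₁ s₂ : List (Symbol T g.NT)} {w₁ w₂ : List T} {m n : ℕ}
    (h₁ : g.Yields s₁ w₁ m) (h₂ : g.Yields s₂ w₂ n) : g.Yields (s₁ ++ s₂) (w₁ ++ w₂) (m + n) := by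
  induction h₁ with
  | nil => simpa using h₂
  | terminal t _ ih => exact .terminal t ih
  | @node r hr s v₁ v₂ k l h _ _ ih =>
    have := Yields.node hr h ih
    rw [List.append_assoc, List.cons_append]
    convert this using 1
    lia

lemma Yields.exists_of_append {s₁ s₂ : List (Symbol T g.NT)} {w : List T} {n : ℕ}
    (h : g.Yields (s₁ ++ s₂) w n) :
    ∃ w₁ w₂ n₁ n₂, w = w₁ ++ w₂ ∧ g.Yields s₁ w₁ n₁ ∧ g.Yields s₂ w₂ n₂ := by
  induction s₁ generalizing w n with
  | nil => exact ⟨[], w, 0, n, rfl, .nil, h⟩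
  | cons x s₁ ih =>
    rw [List.cons_append] at h
    cases h with
    | terminal t h =>
      obtain ⟨w₁, w₂, n₁, n₂, rfl, h₁, h₂⟩ := ih h
      exact ⟨t :: w₁, w₂, n₁, n₂, rfl, .terminal t h₁, h₂⟩
    | @node r hr _ v₁ v₂ k l h₀ h =>
      obtain ⟨w₁, w₂, n₁, n₂, rfl, h₁, h₂⟩ := ih h
      exact ⟨v₁ ++ w₁, w₂, _, n₂, by simp, .node hr h₀ h₁, h₂⟩

lemma Derives.exists_yields {s : List (Symbol T g.NT)} {w : List T}
    (h : g.Derives s (w.map .terminal)) : ∃ n, g.Yields s w n := by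
  induction h using Relation.ReflTransGen.head_induction_on with
  | refl => exact ⟨0, yields_map_terminal w⟩
  | head h _ ih =>
    obtain ⟨r, hr, h⟩ := h
    obtain ⟨p, q, rfl, rfl⟩ := h.exists_parts
    obtain ⟨n, hn⟩ := ih
    obtain ⟨w', w₃, n', n₃, rfl, h', h₃⟩ := hn.exists_of_append
    obtain ⟨w₁, w₂, n₁, n₂, rfl, h₁, h₂⟩ := h'.exists_of_append
    exact ⟨_, by simpa using (h₁.append (.node hr h₂ .nil)).append h₃⟩

/-- `g.Context s u B z c`: a parse tree with a hole, whose roots are `s` and whose hole stands for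
the nonterminal `B`. It puts `u` to the left and `z` to the right of whatever fills the hole, and
it has `c` inner nodes. -/
def Context (g : ContextFreeGrammar T) (s : List (Symbol T g.NT)) (u : List T) (B : g.NT)
    (z : List T) (c : ℕ) : Prop :=
  ∀ x m, g.Yields [.nonterminal B] x m → g.Yields s (u ++ x ++ z) (m + c)

lemma Context.terminal {s : List (Symbol T g.NT)} {u z : List T} {B : g.NT} {c : ℕ}
    (h : g.Context s u B z c) (t : T) : g.Context (.terminal t :: s) (t :: u) B z c :=
  fun x m hx ↦ .terminal t (h x m hx)

lemma Context.node_child {r : ContextFreeRule T g.NT} (hr : r ∈ g.rules)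
    {s : List (Symbol T g.NT)} {u z w : List T} {B : g.NT} {c n : ℕ}
    (h : g.Context r.output u B z c) (hs : g.Yields s w n) :
    g.Context (.nonterminal r.input :: s) u B (z ++ w) (c + n + 1) := fun x m hx ↦ by
  have := Yields.node hr (h x m hx) hs
  rw [← List.append_assoc]
  convert this using 1
  lia

lemma Context.node_sibling {r : ContextFreeRule T g.NT} (hr : r ∈ g.rules)
    {s : List (Symbol T g.NT)} {u z w : List T} {B : g.NT} {c n : ℕ}
    (h : g.Context s u B z c) (hw : g.Yields r.output w n) :
    g.Context (.nonterminal r.input :: s) (w ++ u) B z (c + n + 1) := fun x m hx ↦ by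
  have := Yields.node hr hw (h x m hx)
  rw [List.append_assoc, List.append_assoc, ← List.append_assoc u]
  convert this using 1
  lia

/-- Filling the hole of a context with any number of copies of a context of the type `B ⇒ v B y`. -/
lemma Context.pump {s : List (Symbol T g.NT)} {u v x y z : List T} {B : g.NT} {c d m : ℕ}
    (h₁ : g.Context s u B z c) (h₂ : g.Context [.nonterminal B] v B y d)
    (h₃ : g.Yields [.nonterminal B] x m) (i : ℕ) :
    ∃ n, g.Yields s (u ++ (List.replicate i v).flatten ++ x ++ (List.replicate i y).flatten ++ z)
      n := by
  have key : ∃ n, g.Yields [.nonterminal B]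
      ((List.replicate i v).flatten ++ x ++ (List.replicate i y).flatten) n := by
    induction i with
    | zero => exact ⟨m, by simpa using h₃⟩
    | succ i ih =>
      obtain ⟨n, hn⟩ := ih
      refine ⟨n + d, ?_⟩
      have := h₂ _ _ hn
      rw [List.replicate_succ, List.replicate_succ']
      simpa using this
  obtain ⟨n, hn⟩ := key
  exact ⟨n + c, by simpa using h₁ _ _ hn⟩

/-- `g.Repeats p s w n`: some parse forest of `w` from `s` with `n` inner nodes has a nonterminal
`B` below another occurrence of `B`, the upper one of which generates at most `p` letters. -/
def Repeats (g : ContextFreeGrammar T) (p : ℕ) (s : List (Symbol T g.NT)) (w : List T) (n : ℕ) :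
    Prop :=
  ∃ (u v x y z : List T) (B : g.NT) (c d m : ℕ), w = u ++ v ++ x ++ y ++ z ∧
    (v ++ x ++ y).length ≤ p ∧ g.Context s u B z c ∧ g.Context [.nonterminal B] v B y (d + 1) ∧
    g.Yields [.nonterminal B] x m ∧ n = m + (d + 1) + c

open Classical in
/-- A parse forest either has a repeated nonterminal on a path, or its yield is bounded in terms of
the number of nonterminals on a path. The set `S` consists of the nonterminals on a path that has
the most of them. -/
lemma Yields.repeats_or_length_le {M : ℕ} (hM : 0 < M) (hg : ∀ r ∈ g.rules, r.output.length ≤ M)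
    {s : List (Symbol T g.NT)} {w : List T} {n : ℕ} (h : g.Yields s w n) :
    g.Repeats (M ^ ((g.rules.image ContextFreeRule.input).card + 1)) s w n ∨
      ∃ S ⊆ g.rules.image ContextFreeRule.input, w.length ≤ s.length * M ^ S.card ∧
        ∀ B ∈ S, ∃ u x z c m, w = u ++ x ++ z ∧ g.Context s u B z c ∧
          g.Yields [.nonterminal B] x m ∧ n = m + c := by
  induction h with
  | nil => exact .inr ⟨∅, by simp⟩
  | @terminal t s w n h ih =>
    obtain ⟨u, v, x, y, z, B, c, d, m, rfl, hl, h₁, h₂, h₃, rfl⟩ | ⟨S, hS, hl, hB⟩ := ih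
    · exact .inl ⟨t :: u, v, x, y, z, B, c, d, m, rfl, hl, h₁.terminal t, h₂, h₃, rfl⟩
    · refine .inr ⟨S, hS, ?_, fun B hBS ↦ ?_⟩
      · have : 0 < M ^ S.card := by positivity
        simp only [List.length_cons, add_mul]
        lia
      · obtain ⟨u, x, z, c, m, rfl, h₁, h₂, rfl⟩ := hB B hBS
        exact ⟨t :: u, x, z, c, m, rfl, h₁.terminal t, h₂, rfl⟩
  | @node r hr s w₁ w₂ m₁ m₂ h₁ h₂ ih₁ ih₂ =>
    obtain ⟨u, v, x, y, z, B, c, d, m, rfl, hl, k₁, k₂, k₃, rfl⟩ | ⟨S₁, hS₁, hl₁, hB₁⟩ := ih₁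
    · exact .inl ⟨u, v, x, y, z ++ w₂, B, _, d, m, by simp, hl, k₁.node_child hr h₂, k₂, k₃,
        by lia⟩
    obtain ⟨u, v, x, y, z, B, c, d, m, rfl, hl, k₁, k₂, k₃, rfl⟩ | ⟨S₂, hS₂, hl₂, hB₂⟩ := ih₂
    · exact .inl ⟨w₁ ++ u, v, x, y, z, B, _, d, m, by simp, hl, k₁.node_sibling hr h₁, k₂, k₃,
        by lia⟩
    have hr' : r.input ∈ g.rules.image ContextFreeRule.input := Finset.mem_image_of_mem _ hr
    have hl₁' : w₁.length ≤ M ^ (S₁.card + 1) := by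
      rw [pow_succ']
      exact hl₁.trans (Nat.mul_le_mul_right _ (hg r hr))
    by_cases hrS : r.input ∈ S₁
    · obtain ⟨v, x, y, c, m, rfl, k₁, k₂, rfl⟩ := hB₁ _ hrS
      refine .inl ⟨[], v, x, y, w₂, r.input, m₂, c, m, by simp, ?_, fun x' m' hx' ↦ ?_, ?_, k₂,
        by lia⟩
      · exact hl₁'.trans (Nat.pow_le_pow_right hM (by gcongr))
      · exact hx'.append h₂
      · simpa using k₁.node_child hr .nil
    have hl₁'' : w₁.length ≤ M ^ (insert r.input S₁).card := by
      rwa [Finset.card_insert_of_notMem hrS]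
    refine .inr ?_
    rcases le_total (insert r.input S₁).card S₂.card with hc | hc
    · refine ⟨S₂, hS₂, ?_, fun B hBS ↦ ?_⟩
      · have := hl₁''.trans (Nat.pow_le_pow_right hM hc)
        simp only [List.length_append, List.length_cons, add_mul]
        lia
      · obtain ⟨u, x, z, c, m, rfl, k₁, k₂, rfl⟩ := hB₂ B hBS
        exact ⟨w₁ ++ u, x, z, _, m, by simp, k₁.node_sibling hr h₁, k₂, by lia⟩
    · refine ⟨insert r.input S₁, Finset.insert_subset hr' hS₁, ?_, fun B hBS ↦ ?_⟩
      · have := hl₂.trans (Nat.mul_le_mul_left _ (Nat.pow_le_pow_right hM hc))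
        simp only [List.length_append, List.length_cons, add_mul]
        lia
      · rcases Finset.mem_insert.1 hBS with rfl | hBS
        · refine ⟨[], w₁, w₂, m₂, m₁ + 1, by simp, fun x' m' hx' ↦ hx'.append h₂, ?_, by lia⟩
          simpa using Yields.node hr h₁ .nil
        · obtain ⟨u, x, z, c, m, rfl, k₁, k₂, rfl⟩ := hB₁ B hBS
          exact ⟨u, x, z ++ w₂, _, m, by simp, k₁.node_child hr h₂, k₂, by lia⟩

end ContextFreeGrammar

/-- The **pumping lemma** for context-free languages. The pumped factors are not both empty because
the parse tree that is cut is a smallest parse tree of its word. -/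
theorem Language.IsContextFree.pumping_lemma {T : Type*} {L : Language T} (hL : L.IsContextFree) :
    ∃ p : ℕ, ∀ w ∈ L, p < w.length → ∃ u v x y z : List T, w = u ++ v ++ x ++ y ++ z ∧
      (v ++ x ++ y).length ≤ p ∧ v ++ y ≠ [] ∧
      ∀ i, u ++ (List.replicate i v).flatten ++ x ++ (List.replicate i y).flatten ++ z ∈ L := by
  classical
  obtain ⟨g, rfl⟩ := hL
  set M := g.rules.sup (fun r ↦ r.output.length) + 1
  have hM : 0 < M := Nat.succ_pos _
  have hg : ∀ r ∈ g.rules, r.output.length ≤ M := fun r hr ↦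
    (Finset.le_sup (f := fun r : ContextFreeRule T g.NT ↦ r.output.length) hr).trans
      (Nat.le_succ _)
  refine ⟨M ^ ((g.rules.image ContextFreeRule.input).card + 1), fun w hw hlen ↦ ?_⟩
  have hex : ∃ n, g.Yields [.nonterminal g.initial] w n :=
    ContextFreeGrammar.Derives.exists_yields hw
  have hmin := fun k ↦ @Nat.find_min _ _ hex k
  obtain ⟨u, v, x, y, z, B, c, d, m, rfl, hl, h₁, h₂, h₃, hn⟩ | ⟨S, hS, hl, -⟩ :=
    (Nat.find_spec hex).repeats_or_length_le hM hg
  · refine ⟨u, v, x, y, z, rfl, hl, fun hvy ↦ ?_, fun i ↦ ?_⟩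
    · obtain ⟨rfl, rfl⟩ := List.append_eq_nil_iff.1 hvy
      exact hmin (m + c) (by lia) (by simpa using h₁ x m h₃)
    · obtain ⟨n, hn⟩ := h₁.pump h₂ h₃ i
      exact hn.derives
  · have : M ^ S.card ≤ M ^ ((g.rules.image ContextFreeRule.input).card + 1) :=
      Nat.pow_le_pow_right hM ((Finset.card_le_card hS).trans (Nat.le_succ _))
    simp only [List.length_singleton, one_mul] at hl
    lia

/-! ### The least rotations of binary words do not form a context-free language -/

section Rotations

open List

variable {X : Type*} {a b : X}

lemma append_eq_replicate_append {c : X} {u t s : List X} {n : ℕ}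
    (h : u ++ t = replicate n c ++ s) :
    (∃ k l, k + l = n ∧ u = replicate k c ∧ t = replicate l c ++ s) ∨
      ∃ u', u = replicate n c ++ u' ∧ u' ++ t = s := by
  rcases append_eq_append_iff.1 h with ⟨t', h₁, rfl⟩ | ⟨u', rfl, rfl⟩
  · obtain ⟨h₁, h₂, h₃⟩ := append_eq_replicate_iff.1 h₁.symm
    exact .inl ⟨_, _, h₁, h₂, by rw [← h₃]⟩
  · exact .inr ⟨u', rfl, rfl⟩

/-- The positions of three consecutive factors of a word with two runs: the border of the runs lies
in the first factor, in the second or in the third. -/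
lemma append_append_eq_replicate_append_replicate {c d : X} {v x y : List X} {i j : ℕ}
    (h : v ++ x ++ y = replicate i c ++ replicate j d) :
    (∃ j₁ j₂ j₃, j₁ + j₂ + j₃ = j ∧ v = replicate i c ++ replicate j₁ d ∧ x = replicate j₂ d ∧
      y = replicate j₃ d) ∨
    (∃ i₁ i₂ j₁ j₂, i₁ + i₂ = i ∧ j₁ + j₂ = j ∧ v = replicate i₁ c ∧
      x = replicate i₂ c ++ replicate j₁ d ∧ y = replicate j₂ d) ∨
    (∃ i₁ i₂ i₃, i₁ + i₂ + i₃ = i ∧ v = replicate i₁ c ∧ x = replicate i₂ c ∧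
      y = replicate i₃ c ++ replicate j d) := by
  rw [append_assoc] at h
  rcases append_eq_replicate_append h with ⟨i₁, i', rfl, rfl, h'⟩ | ⟨v', rfl, h'⟩
  · rcases append_eq_replicate_append h' with ⟨i₂, i₃, rfl, rfl, rfl⟩ | ⟨x', rfl, h''⟩
    · exact .inr (.inr ⟨i₁, i₂, i₃, by lia, rfl, rfl, rfl⟩)
    · obtain ⟨h₁, h₂, h₃⟩ := append_eq_replicate_iff.1 h''
      exact .inr (.inl ⟨i₁, i', _, _, rfl, h₁, rfl, by rw [← h₂], h₃⟩)
  · obtain ⟨h₁, h₂, h₃⟩ := append_eq_replicate_iff.1 h'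
    obtain ⟨h₄, h₅, h₆⟩ := append_eq_replicate_iff.1 h₃
    exact .inl ⟨_, _, _, by rw [add_assoc, h₄, h₁], by rw [← h₂], h₅, h₆⟩

/-- The positions of a factor of `aⁿ bⁿ aⁿ bⁿ` that is shorter than `n`: either it lies in one of
the four runs, or it meets two adjacent runs. -/
lemma append_append_eq_four_runs {u m z : List X} {n : ℕ} (hm : m.length < n)
    (h : u ++ m ++ z = replicate n a ++ (replicate n b ++ (replicate n a ++ replicate n b))) :
    (∃ k i l, k + i + l = n ∧
      ((u = replicate k a ∧ m = replicate i a ∧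
          z = replicate l a ++ (replicate n b ++ (replicate n a ++ replicate n b))) ∨
        (u = replicate n a ++ replicate k b ∧ m = replicate i b ∧
          z = replicate l b ++ (replicate n a ++ replicate n b)) ∨
        (u = replicate n a ++ (replicate n b ++ replicate k a) ∧ m = replicate i a ∧
          z = replicate l a ++ replicate n b) ∨
        (u = replicate n a ++ (replicate n b ++ (replicate n a ++ replicate k b)) ∧
          m = replicate i b ∧ z = replicate l b))) ∨
    (∃ k i j l, k + i = n ∧ j + l = n ∧ i < n ∧ j < n ∧
      ((u = replicate k a ∧ m = replicate i a ++ replicate j b ∧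
          z = replicate l b ++ (replicate n a ++ replicate n b)) ∨
        (u = replicate n a ++ replicate k b ∧ m = replicate i b ++ replicate j a ∧
          z = replicate l a ++ replicate n b) ∨
        (u = replicate n a ++ (replicate n b ++ replicate k a) ∧
          m = replicate i a ++ replicate j b ∧ z = replicate l b))) := by
  have two : ∀ {c d : X} {i : ℕ} {s : List X}, m ++ z = replicate i c ++ (replicate n d ++ s) →
      (∃ i₁ i₂, i₁ + i₂ = i ∧ m = replicate i₁ c ∧
        z = replicate i₂ c ++ (replicate n d ++ s)) ∨
      ∃ j l, j + l = n ∧ i < n ∧ j < n ∧ m = replicate i c ++ replicate j d ∧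
        z = replicate l d ++ s := by
    intro c d i s h
    rcases append_eq_replicate_append h with ⟨i₁, i₂, hi, h₁, h₂⟩ | ⟨m', rfl, h'⟩
    · exact .inl ⟨i₁, i₂, hi, h₁, h₂⟩
    rcases append_eq_replicate_append h' with ⟨j, l, hj, rfl, rfl⟩ | ⟨m'', rfl, -⟩
    · simp only [length_append, length_replicate] at hm
      exact .inr ⟨j, l, hj, by lia, by lia, rfl, rfl⟩
    · simp only [length_append, length_replicate] at hm
      lia
  rw [append_assoc] at h
  rcases append_eq_replicate_append h with ⟨k, i, hk, h₀, h'⟩ | ⟨u, rfl, h'⟩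
  · rcases two h' with ⟨i₁, i₂, hi, h₁, h₂⟩ | ⟨j, l, hj, hi, hj', h₁, h₂⟩
    · exact .inl ⟨k, i₁, i₂, by lia, .inl ⟨h₀, h₁, h₂⟩⟩
    · exact .inr ⟨k, i, j, l, hk, hj, hi, hj', .inl ⟨h₀, h₁, h₂⟩⟩
  rcases append_eq_replicate_append h' with ⟨k, i, hk, rfl, h''⟩ | ⟨u, rfl, h''⟩
  · rcases two h'' with ⟨i₁, i₂, hi, h₁, h₂⟩ | ⟨j, l, hj, hi, hj', h₁, h₂⟩
    · exact .inl ⟨k, i₁, i₂, by lia, .inr (.inl ⟨rfl, h₁, h₂⟩)⟩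
    · exact .inr ⟨k, i, j, l, hk, hj, hi, hj', .inr (.inl ⟨rfl, h₁, h₂⟩)⟩
  rcases append_eq_replicate_append h'' with ⟨k, i, hk, rfl, h₃⟩ | ⟨u, rfl, h₃⟩
  · rcases two (s := []) (by simpa using h₃) with
      ⟨i₁, i₂, hi, h₁, h₂⟩ | ⟨j, l, hj, hi, hj', h₁, h₂⟩
    · exact .inl ⟨k, i₁, i₂, by lia, .inr (.inr (.inl ⟨rfl, h₁, by simpa using h₂⟩))⟩
    · exact .inr ⟨k, i, j, l, hk, hj, hi, hj', .inr (.inr ⟨rfl, h₁, by simpa using h₂⟩)⟩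
  · obtain ⟨h₁, h₂, h₃⟩ := append_eq_replicate_iff.1 h₃
    obtain ⟨h₄, h₅, h₆⟩ := append_eq_replicate_iff.1 h₃
    exact .inl ⟨_, _, _, by rw [add_assoc, h₄, h₁],
      .inr (.inr (.inr ⟨by rw [← h₂], h₅, h₆⟩))⟩

variable {lt : X → X → Prop}

lemma lex_of_lt_left (hab : lt a b) {p q l : ℕ} (hpq : p < q) (hl : 0 < l) (s t : List X) :
    List.Lex lt (replicate q a ++ s) (replicate p a ++ (replicate l b ++ t)) := by
  obtain ⟨e, rfl⟩ := Nat.exists_eq_add_of_lt hpq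
  obtain ⟨l, rfl⟩ := Nat.exists_eq_succ_of_ne_zero hl.ne'
  rw [add_assoc, replicate_add, append_assoc, replicate_succ, replicate_succ]
  exact .append_left _ (.rel hab) _

lemma lex_of_lt_right (hab : lt a b) {p q k : ℕ} (hpq : p < q) (hk : 0 < k) (s t : List X) :
    List.Lex lt (replicate p b ++ (replicate k a ++ s)) (replicate q b ++ t) := by
  obtain ⟨e, rfl⟩ := Nat.exists_eq_add_of_lt hpq
  obtain ⟨k, rfl⟩ := Nat.exists_eq_succ_of_ne_zero hk.ne'
  rw [add_assoc, replicate_add, append_assoc, replicate_succ, replicate_succ]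
  exact .append_left _ (.rel hab) _

/-- Let every word of `L` be the least among its rotations. Then pumping a short factor of
`aⁿ bⁿ aⁿ bⁿ` leads out of `L`, either when `v` and `y` are removed or when they are doubled. As
long as `v` and `y` both lie in single runs, this is a comparison of the exponents of words with
four runs. If one of them contains the border of two runs and removing them does not lead out of
`L`, doubling them creates a run that is shorter than `n`, and some rotation of the result has a
longer run of `a` or a shorter run of `b` in the place where the two first differ. -/
lemma false_of_pump_four_runs (hab : lt a b) {L : Language X}
    (hL : ∀ p s, p ++ s ∈ L → ¬ List.Lex lt (s ++ p) (p ++ s)) {n : ℕ} {u v x y z : List X}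
    (h : u ++ (v ++ x ++ y) ++ z =
      replicate n a ++ (replicate n b ++ (replicate n a ++ replicate n b)))
    (hn : (v ++ x ++ y).length < n) (hvy : v ++ y ≠ [])
    (h₀ : u ++ x ++ z ∈ L) (h₂ : u ++ (v ++ v) ++ x ++ (y ++ y) ++ z ∈ L) : False := by
  have merge : ∀ (i j : ℕ) (c : X) (s : List X),
      replicate i c ++ (replicate j c ++ s) = replicate (i + j) c ++ s := by
    intro i j c s
    rw [← append_assoc, replicate_add]
  have hn0 : 0 < n := by lia
  -- Compare `aᵖ b^q aʳ bˢ` with its rotation `aʳ bˢ aᵖ b^q`.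
  have four : ∀ {w : List X} (p q r s : ℕ), w ∈ L →
      w = replicate p a ++ (replicate q b ++ (replicate r a ++ replicate s b)) →
      0 < q → 0 < r → r ≤ p ∧ (p = r → q ≤ s) := by
    intro w p q r s hw he hq hr
    have hw' := hL (replicate p a ++ replicate q b) (replicate r a ++ replicate s b)
      (by simpa [he] using hw)
    refine ⟨?_, ?_⟩
    · by_contra hlt
      refine hw' ?_
      simp only [append_assoc]
      exact lex_of_lt_left hab (not_le.1 hlt) hq _ _
    · rintro rfl
      by_contra hlt
      refine hw' ?_
      simp only [append_assoc]
      exact .append_left _ (lex_of_lt_right hab (not_le.1 hlt) hr _ _) _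
  have hlen : 0 < (v ++ y).length := length_pos_iff.2 hvy
  rcases append_append_eq_four_runs hn h with
    ⟨k, i, l, hkil, h'⟩ | ⟨k, i, j, l, hki, hjl, hi, hj, h'⟩
  · -- The pumped factors lie in a single run.
    have single : ∀ {c : X}, v ++ x ++ y = replicate i c → ∃ i₁ i₂ i₃, i₁ + i₂ + i₃ = i ∧
        v = replicate i₁ c ∧ x = replicate i₂ c ∧ y = replicate i₃ c := by
      intro c h
      obtain ⟨h₁, h₂, h₃⟩ := append_eq_replicate_iff.1 h
      obtain ⟨h₄, h₅, h₆⟩ := append_eq_replicate_iff.1 h₂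
      exact ⟨_, _, _, by rw [h₄, h₁], h₅, h₆, h₃⟩
    rcases h' with ⟨rfl, hm, rfl⟩ | ⟨rfl, hm, rfl⟩ | ⟨rfl, hm, rfl⟩ | ⟨rfl, hm, rfl⟩ <;>
    obtain ⟨i₁, i₂, i₃, hi, rfl, rfl, rfl⟩ := single hm <;>
    simp only [length_append, length_replicate] at hlen
    · have := four (k + (i₂ + l)) n n n h₀ (by simp [merge, add_assoc]) hn0 hn0
      lia
    · have := four n (k + (i₁ + (i₁ + (i₂ + (i₃ + (i₃ + l)))))) n n h₂ (by simp [merge, add_assoc])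
        (by lia) hn0
      lia
    · have := four n n (k + (i₁ + (i₁ + (i₂ + (i₃ + (i₃ + l)))))) n h₂
        (by simp [merge, add_assoc]) hn0 (by lia)
      lia
    · have := four n n n (k + (i₂ + l)) h₀ (by simp [add_assoc]) hn0 hn0
      lia
  have rot : ∀ {w : List X} (p s : List X), w ∈ L → w = p ++ s →
      ¬ List.Lex lt (s ++ p) (p ++ s) := by
    rintro _ p s hw rfl
    exact hL p s hw
  rcases h' with ⟨rfl, hm, rfl⟩ | ⟨rfl, hm, rfl⟩ | ⟨rfl, hm, rfl⟩ <;>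
  rcases append_append_eq_replicate_append_replicate hm with
    ⟨j₁, j₂, j₃, hj₁, rfl, rfl, rfl⟩ | ⟨i₁, i₂, j₁, j₂, hi₁, hj₁, rfl, rfl, rfl⟩ |
    ⟨i₁, i₂, i₃, hi₁, rfl, rfl, rfl⟩ <;>
  simp only [length_append, length_replicate] at hlen
  -- The pumped factors lie in the first two runs.
  · have := four k (j₂ + l) n n h₀ (by simp [merge]) (by lia) hn0
    obtain rfl : i = 0 := by lia
    have := four k (j₁ + (j₁ + (j₂ + (j₃ + (j₃ + l))))) n n h₂ (by simp [merge, add_assoc])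
      (by lia) hn0
    lia
  · have := four (k + i₂) (j₁ + l) n n h₀ (by simp [merge]) (by lia) hn0
    obtain rfl : i₁ = 0 := by lia
    have := four (k + i₂) (j₁ + (j₂ + (j₂ + l))) n n h₂ (by simp [merge, add_assoc])
      (by lia) hn0
    lia
  · have := four (k + i₂) l n n h₀ (by simp) (by lia) hn0
    obtain rfl : i₁ = 0 := by lia
    obtain rfl : i₃ = 0 := by lia
    have := four (k + i₂) (j + (j + l)) n n h₂ (by simp [merge, add_assoc]) (by lia) hn0
    lia
  -- The pumped factors lie in the second and the third run. When the border
  -- lies in `v` or in `y`, the smaller rotation starts with the last two runs.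
  · rcases Nat.eq_zero_or_pos i with rfl | hi0
    · have := four n k (j₁ + (j₁ + (j₂ + (j₃ + (j₃ + l))))) n h₂ (by simp [merge, add_assoc])
        (by lia) (by lia)
      lia
    · have e : j₁ + (j₂ + (j₃ + (j₃ + l))) = n + j₃ := by lia
      refine rot (replicate n a ++ (replicate n b ++ (replicate j₁ a ++ replicate i b)))
        (replicate (n + j₃) a ++ replicate n b) h₂ ?_ ?_
      · rw [← e, ← hki]
        simp [merge, add_assoc]
      · simp only [append_assoc]
        rcases Nat.eq_zero_or_pos j₃ with rfl | hj0
        · refine .append_left _ (.append_left _ ?_ _) _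
          exact lex_of_lt_left hab (by lia) hi0 _ _
        · exact lex_of_lt_left hab (by lia) hn0 _ _
  · have := four n (k + (i₁ + (i₁ + i₂))) (j₁ + (j₂ + (j₂ + l))) n h₂
      (by simp [merge, add_assoc]) (by lia) (by lia)
    lia
  · rcases Nat.eq_zero_or_pos i₃ with rfl | hi0
    · have := four n (k + (i₁ + (i₁ + i₂))) (j + (j + l)) n h₂ (by simp [merge, add_assoc])
        (by lia) (by lia)
      lia
    · have e : k + (i₁ + (i₁ + (i₂ + i₃))) = n + i₁ := by lia
      refine rot (replicate n a ++ (replicate (n + i₁) b ++ (replicate j a ++ replicate i₃ b)))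
        (replicate n a ++ replicate n b) h₂ ?_ ?_
      · rw [← e, ← hjl]
        simp [merge, add_assoc]
      · simp only [append_assoc]
        refine .append_left _ ?_ _
        rcases Nat.eq_zero_or_pos i₁ with rfl | hi₁
        · refine .append_left _ ?_ _
          exact lex_of_lt_left hab hj hi0 _ _
        · exact lex_of_lt_right hab (by lia) hn0 _ _
  -- The pumped factors lie in the last two runs. When the border lies in `v` or in `y`, the smaller
  -- rotation starts after the first two runs `aⁿ bⁿ`: it begins with more than `n` letters `a`, or
  -- with `aⁿ` and then fewer than `n` letters `b`.
  · rcases Nat.eq_zero_or_pos i with rfl | hi0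
    · have := four n n k (j₂ + l) h₀ (by simp) hn0 (by lia)
      lia
    · refine rot (replicate n a ++ replicate n b) (replicate (k + i) a ++ (replicate j₁ b ++
        (replicate i a ++ replicate (j₁ + (j₂ + (j₃ + (j₃ + l)))) b))) h₂ ?_ ?_
      · simp [merge, add_assoc]
      · rw [hki]
        simp only [append_assoc]
        exact .append_left _ (lex_of_lt_right hab (by lia) hi0 _ _) _
  · have := four n n (k + i₂) (j₁ + l) h₀ (by simp [merge]) hn0 (by lia)
    have := four n n (k + (i₁ + (i₁ + i₂))) (j₁ + (j₂ + (j₂ + l))) h₂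
      (by simp [merge, add_assoc]) hn0 (by lia)
    lia
  · rcases Nat.eq_zero_or_pos i₃ with rfl | hi0
    · have := four n n (k + i₂) l h₀ (by simp) hn0 (by lia)
      have := four n n (k + (i₁ + (i₁ + i₂))) (j + (j + l)) h₂ (by simp [add_assoc]) hn0
        (by lia)
      lia
    · have e : k + (i₁ + (i₁ + (i₂ + i₃))) = n + i₁ := by lia
      refine rot (replicate n a ++ replicate n b) (replicate (n + i₁) a ++ (replicate j b ++
        (replicate i₃ a ++ replicate (j + l) b))) h₂ ?_ ?_
      · rw [← e]
        simp [merge, add_assoc]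
      · simp only [append_assoc]
        rcases Nat.eq_zero_or_pos i₁ with rfl | hi₁
        · exact .append_left _ (lex_of_lt_right hab hj hi0 _ _) _
        · exact lex_of_lt_left hab (by lia) hn0 _ _

/-- The word `aⁿ bⁿ aⁿ bⁿ` is the least among its rotations. -/
lemma four_runs_le_rotation (hab : lt a b) {n : ℕ} {p s : List X}
    (h : p ++ s = replicate n a ++ (replicate n b ++ (replicate n a ++ replicate n b))) :
    p ++ s = s ++ p ∨ List.Lex lt (p ++ s) (s ++ p) := by
  rcases Nat.eq_zero_or_pos n with rfl | hn
  · simp only [replicate_zero, append_nil, append_eq_nil_iff] at h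
    simp [h]
  rw [h]
  rcases append_eq_replicate_append h with ⟨k, i, hk, rfl, rfl⟩ | ⟨p, rfl, h'⟩
  · rcases Nat.eq_zero_or_pos k with rfl | hk0
    · obtain rfl : i = n := by lia
      simp
    · simp only [append_assoc]
      exact .inr (lex_of_lt_left hab (by lia) hn _ _)
  rcases append_eq_replicate_append h' with ⟨k, i, hk, rfl, rfl⟩ | ⟨p, rfl, h''⟩
  · rcases Nat.eq_zero_or_pos i with rfl | hi0
    · obtain rfl : k = n := by lia
      simp
    · simp only [append_assoc]
      exact .inr (lex_of_lt_left hab (p := 0) hn hi0 _ _)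
  rcases append_eq_replicate_append h'' with ⟨k, i, hk, rfl, rfl⟩ | ⟨p, rfl, h₃⟩
  · rcases Nat.eq_zero_or_pos k with rfl | hk0
    · obtain rfl : i = n := by lia
      simp
    · simp only [append_assoc]
      exact .inr (lex_of_lt_left hab (by lia) hn _ _)
  obtain ⟨hps, hp, hs⟩ := append_eq_replicate_iff.1 h₃
  rcases Nat.eq_zero_or_pos s.length with hs0 | hs0
  · obtain rfl := length_eq_zero_iff.1 hs0
    rw [append_nil] at h
    simp only [nil_append]
    exact .inl h.symm
  · rw [hs]
    exact .inr (lex_of_lt_left hab (p := 0) hn hs0 _ _)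

/-- A language whose words are least among their rotations and which contains all the words
`aⁿ bⁿ aⁿ bⁿ` is not context-free. -/
lemma not_isContextFree_of_four_runs_mem (hab : lt a b) {L : Language X}
    (hL : ∀ p s, p ++ s ∈ L → ¬ List.Lex lt (s ++ p) (p ++ s))
    (hmem : ∀ n, replicate n a ++ (replicate n b ++ (replicate n a ++ replicate n b)) ∈ L) :
    ¬ L.IsContextFree := by
  intro hcf
  obtain ⟨p, hp⟩ := hcf.pumping_lemma
  obtain ⟨u, v, x, y, z, hw, hlen, hvy, hpump⟩ := hp _ (hmem (p + 1)) (by simp; lia)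
  refine false_of_pump_four_runs hab hL (n := p + 1) (u := u) (v := v) (x := x) (y := y) (z := z)
    (by simp [hw]) (by lia) hvy ?_ ?_
  · simpa using hpump 0
  · simpa [replicate_succ] using hpump 2

end Rotations

/-! ### Conjugacy of positive words in free groups -/

/-- The positive word `u`, as a word over the letters and their inverses. -/
abbrev positiveWord {α : Type*} (u : List α) : List (α × Bool) := u.map fun a ↦ (a, true)

lemma isReduced_positiveWord {α : Type*} (u : List α) :
    FreeGroup.IsReduced (positiveWord u) := by
  induction u with
  | nil => simp [FreeGroup.IsReduced]
  | cons a u ih =>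
    cases u with
    | nil => simp [FreeGroup.IsReduced]
    | cons b u =>
      simp only [FreeGroup.IsReduced, positiveWord, List.map_cons] at ih ⊢
      exact List.isChain_cons_cons.2 ⟨fun _ ↦ rfl, ih⟩

open FreeGroup in
/-- Positive words that are conjugate in the free group are conjugate in the free monoid. If the
last letter of the conjugator `L` cancels against `u`, the two cancel to leave a rotation of `u`;
if nothing cancels in `L u L⁻¹`, this word is positive only when `L` is empty. -/
lemma isRotated_of_conj_positiveWord {α : Type*} (L : List (α × Bool)) (u v : List α)
    (h : mk L * mk (positiveWord u) * (mk L)⁻¹ = mk (positiveWord v)) : u ~r v := by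
  classical
  induction hn : L.length using Nat.strong_induction_on generalizing L u with
  | _ n ih =>
  subst hn
  by_cases hL : IsReduced L
  swap
  · refine ih _ ?_ (reduce L) u (by rwa [reduce.self]) rfl
    have hs := (reduce.red (L := L)).sublist
    refine lt_of_le_of_ne hs.length_le fun he ↦ hL ?_
    exact .of_reduce_eq (hs.eq_of_length he)
  rcases L.eq_nil_or_concat' with rfl | ⟨L', x, rfl⟩
  · have : mk (positiveWord u) = mk (positiveWord v) := by simpa [← one_eq_mk] using h
    have := congrArg toWord this
    rw [toWord_mk, toWord_mk, (isReduced_positiveWord u).reduce_eq,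
      (isReduced_positiveWord v).reduce_eq] at this
    have := List.map_injective_iff.2 (fun a b h ↦ (Prod.mk.inj h).1) this
    rw [this]
  have hlen : L'.length < (L' ++ [x]).length := by simp
  by_cases hu : u = []
  · subst hu
    have : mk (positiveWord v) = 1 := by
      rw [← h, positiveWord, List.map_nil, ← one_eq_mk, mul_one, mul_inv_cancel]
    have := congrArg toWord this
    rw [toWord_mk, (isReduced_positiveWord v).reduce_eq, toWord_one] at this
    rw [List.map_eq_nil_iff.1 this]
  by_cases h₁ : ∃ a u', u = a :: u' ∧ x = (a, false)
  · obtain ⟨a, u', rfl, rfl⟩ := h₁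
    have hrot : [a] ++ u' ~r u' ++ [a] := List.isRotated_append
    refine hrot.trans (ih _ hlen L' _ ?_ rfl)
    have hx : mk [(a, false)] = (mk [(a, true)])⁻¹ := rfl
    rw [← h, ← List.singleton_append (l := u'), positiveWord, positiveWord, List.map_append,
      List.map_append, ← mul_mk, ← mul_mk, ← mul_mk, hx]
    simp only [List.map_cons, List.map_nil]
    group
  by_cases h₂ : ∃ a u', u = u' ++ [a] ∧ x = (a, true)
  · obtain ⟨a, u', rfl, rfl⟩ := h₂
    have hrot : u' ++ [a] ~r [a] ++ u' := List.isRotated_append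
    refine hrot.trans (ih _ hlen L' _ ?_ rfl)
    rw [← h, positiveWord, positiveWord, List.map_append, List.map_append, ← mul_mk, ← mul_mk,
      ← mul_mk]
    simp only [List.map_cons, List.map_nil]
    group
  have hr : IsReduced (L' ++ [x] ++ positiveWord u ++ invRev (L' ++ [x])) := by
    have hL' : IsReduced (invRev (L' ++ [x])) :=
      .of_reduce_eq (by rw [reduce_invRev, hL.reduce_eq])
    refine (hL.append (isReduced_positiveWord u) ?_).append hL' ?_
    · rintro _ hy b hb he
      obtain rfl : x = _ := by simpa using hy
      obtain ⟨a, u', rfl⟩ := List.exists_cons_of_ne_nil hu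
      obtain rfl : (a, true) = b := by simpa using hb
      by_contra hx
      exact h₁ ⟨a, u', rfl, Prod.ext he (by simpa using hx)⟩
    · rintro b hb y hy he
      obtain rfl : (x.1, !x.2) = y := by simpa [invRev] using hy
      obtain ⟨u', a, rfl⟩ := (List.eq_nil_or_concat' u).resolve_left hu
      obtain rfl : (a, true) = b := by
        rw [positiveWord, List.map_append, ← List.append_assoc, List.map_singleton,
          List.getLast?_concat] at hb
        simpa using hb
      by_contra hx
      exact h₂ ⟨a, u', rfl, Prod.ext he.symm (by simpa using hx)⟩
  have := congrArg toWord h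
  rw [inv_mk, mul_mk, mul_mk, toWord_mk, toWord_mk, hr.reduce_eq,
    (isReduced_positiveWord v).reduce_eq] at this
  have hx : x ∈ positiveWord v := by simp [← this]
  have hx' : (x.1, !x.2) ∈ positiveWord v := by simp [← this, invRev]
  simp only [positiveWord, List.mem_map] at hx hx'
  obtain ⟨a, -, rfl⟩ := hx
  simp at hx'

/-! ### Conjugacy normal forms in right-angled Artin groups -/

/-- A word of a spherical conjugacy language is the least among its rotations. -/
lemma not_lex_rotation_of_mem_conjSL {X G : Type*} [Group G] {ev : X → G} {lt : X → X → Prop}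
    [IsStrictTotalOrder X lt] {p s : List X} (h : p ++ s ∈ conjSL ev lt) :
    ¬ List.Lex lt (s ++ p) (p ++ s) := by
  obtain ⟨c, hc, hmin⟩ := h
  have hconj : ConjClasses.mk (wordEval ev (s ++ p)) = c := by
    rw [← hc, ConjClasses.mk_eq_mk_iff_isConj, isConj_iff]
    exact ⟨wordEval ev p, by simp [wordEval, mul_assoc]⟩
  intro hlex
  rcases hmin _ hconj with he | hlt
  · rw [he] at hlex
    exact irrefl_of (List.Lex lt) _ hlex
  · rw [List.shortlex_iff_lex (by simp [add_comm])] at hlt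
    exact asymm_of (List.Lex lt) hlex hlt

section Retraction

variable {V : Type*} {Γ : SimpleGraph V} {a b : V}

open Classical in
/-- The retraction of `A_Γ` to the free group on two vertices `a` and `b` that are not adjacent.
It kills all other generators, and its codomain is taken to be the free group on all vertices. -/
noncomputable def raagRetraction (hab : ¬ Γ.Adj a b) : RAAG Γ →* FreeGroup V :=
  PresentedGroup.toGroup (rels := raagRelators Γ)
    (f := fun v ↦ if v = a ∨ v = b then FreeGroup.of v else 1) <| by
    rintro _ ⟨c, d, hcd, rfl⟩
    have hcd' : ¬ ((c = a ∨ c = b) ∧ (d = a ∨ d = b)) := by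
      rintro ⟨rfl | rfl, rfl | rfl⟩
      exacts [Γ.irrefl hcd, hab hcd, hab hcd.symm, Γ.irrefl hcd]
    by_cases hc : c = a ∨ c = b
    · have hd : ¬ (d = a ∨ d = b) := fun hd ↦ hcd' ⟨hc, hd⟩
      simp [hd]
    · simp [hc]

lemma raagRetraction_raagLetter (hab : ¬ Γ.Adj a b) {v : V} (hv : v = a ∨ v = b) (i : Bool) :
    raagRetraction hab (raagLetter Γ (v, i)) = FreeGroup.mk [(v, i)] := by
  cases i
  · simp only [raagLetter, raagRetraction, map_inv, PresentedGroup.toGroup.of, hv, if_true,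
      Bool.false_eq_true, if_false]
    rfl
  · simp only [raagLetter, raagRetraction, PresentedGroup.toGroup.of, hv, if_true]
    rfl

lemma raagRetraction_raagLetter_of_ne (hab : ¬ Γ.Adj a b) {v : V} (hv : ¬ (v = a ∨ v = b))
    (i : Bool) : raagRetraction hab (raagLetter Γ (v, i)) = 1 := by
  cases i <;> simp [raagLetter, raagRetraction, hv]

lemma raagRetraction_positiveWord (hab : ¬ Γ.Adj a b) {u : List V} (hu : ∀ v ∈ u, v = a ∨ v = b) :
    raagRetraction hab (wordEval (raagLetter Γ) (positiveWord u)) =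
      FreeGroup.mk (positiveWord u) := by
  induction u with
  | nil => simp [wordEval, FreeGroup.one_eq_mk]
  | cons v u ih =>
    rw [List.forall_mem_cons] at hu
    have := ih hu.2
    simp only [wordEval, positiveWord, List.map_cons, List.prod_cons, map_mul] at this ⊢
    rw [this, raagRetraction_raagLetter hab hu.1, FreeGroup.mul_mk]
    rfl

/-- The exponent sum of an element of `A_Γ` in the two generators `a` and `b`. -/
noncomputable def raagExponentSum (hab : ¬ Γ.Adj a b) : RAAG Γ →* Multiplicative ℤ :=
  (FreeGroup.lift fun _ ↦ Multiplicative.ofAdd 1).comp (raagRetraction hab)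

lemma raagExponentSum_positiveWord (hab : ¬ Γ.Adj a b) {u : List V}
    (hu : ∀ v ∈ u, v = a ∨ v = b) :
    (raagExponentSum hab (wordEval (raagLetter Γ) (positiveWord u))).toAdd = u.length := by
  rw [raagExponentSum, MonoidHom.comp_apply, raagRetraction_positiveWord hab hu]
  simp [positiveWord, Function.comp_def]

lemma raagExponentSum_cons (hab : ¬ Γ.Adj a b) (x : V × Bool) (w : List (V × Bool)) :
    (raagExponentSum hab (wordEval (raagLetter Γ) (x :: w))).toAdd =
      (raagExponentSum hab (raagLetter Γ x)).toAdd +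
        (raagExponentSum hab (wordEval (raagLetter Γ) w)).toAdd := by
  simp [wordEval]

/-- The letters `a` and `b` are the only ones whose exponent sum is as large as `1`. -/
lemma raagExponentSum_raagLetter (hab : ¬ Γ.Adj a b) (x : V × Bool) :
    (raagExponentSum hab (raagLetter Γ x)).toAdd ≤ 0 ∨
      ((x.1 = a ∨ x.1 = b) ∧ x.2 = true) ∧
        (raagExponentSum hab (raagLetter Γ x)).toAdd = 1 := by
  obtain ⟨v, i⟩ := x
  rw [raagExponentSum, MonoidHom.comp_apply]
  by_cases hv : v = a ∨ v = b
  · rw [raagRetraction_raagLetter hab hv]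
    cases i <;> simp [hv]
  · rw [raagRetraction_raagLetter_of_ne hab hv]
    simp

lemma raagExponentSum_le_length (hab : ¬ Γ.Adj a b) (w : List (V × Bool)) :
    (raagExponentSum hab (wordEval (raagLetter Γ) w)).toAdd ≤ w.length := by
  induction w with
  | nil => simp [wordEval]
  | cons x w ih =>
    rw [raagExponentSum_cons, List.length_cons]
    rcases raagExponentSum_raagLetter hab x with h | ⟨-, h⟩ <;> push_cast <;> lia

lemma exists_positiveWord_of_raagExponentSum_eq (hab : ¬ Γ.Adj a b) {w : List (V × Bool)}
    (h : (raagExponentSum hab (wordEval (raagLetter Γ) w)).toAdd = w.length) :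
    ∃ u : List V, w = positiveWord u ∧ ∀ v ∈ u, v = a ∨ v = b := by
  induction w with
  | nil => exact ⟨[], by simp⟩
  | cons x w ih =>
    have hle := raagExponentSum_le_length hab w
    rw [raagExponentSum_cons, List.length_cons] at h
    push_cast at h
    rcases raagExponentSum_raagLetter hab x with hx | ⟨⟨hx, hx'⟩, hx₁⟩
    · lia
    · obtain ⟨u, rfl, hu⟩ := ih (by lia)
      exact ⟨x.1 :: u, by simp [← hx'], List.forall_mem_cons.2 ⟨hx, hu⟩⟩

/-- A positive word in two non-adjacent vertices belongs to the spherical conjugacy language as soon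
as it is the least among its rotations: a conjugate word is longer, unless all its letters are `a`
or `b`, and then the two words are conjugate in a free group. -/
lemma positiveWord_mem_conjSL (hab : ¬ Γ.Adj a b) (lt : V × Bool → V × Bool → Prop) {u : List V}
    (hu : ∀ v ∈ u, v = a ∨ v = b)
    (hmin : ∀ u', u ~r u' →
      positiveWord u = positiveWord u' ∨ List.Lex lt (positiveWord u) (positiveWord u')) :
    positiveWord u ∈ conjSL (raagLetter Γ) lt := by
  refine ⟨_, rfl, fun w hw ↦ ?_⟩
  rw [ConjClasses.mk_eq_mk_iff_isConj] at hw
  have hsum : (raagExponentSum hab (wordEval (raagLetter Γ) w)).toAdd = u.length := by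
    rw [← raagExponentSum_positiveWord hab hu]
    exact congrArg _ (isConj_iff_eq.1 ((raagExponentSum hab).map_isConj hw))
  have hle := raagExponentSum_le_length hab w
  rcases lt_or_ge u.length w.length with hlt | hge
  · exact .inr (.of_length_lt (by simpa using hlt))
  obtain ⟨u', rfl, hu'⟩ := exists_positiveWord_of_raagExponentSum_eq hab (w := w) (by lia)
  have hconj := (raagRetraction hab).map_isConj hw.symm
  rw [raagRetraction_positiveWord hab hu, raagRetraction_positiveWord hab hu', isConj_iff] at hconj
  obtain ⟨g, hg⟩ := hconj
  obtain ⟨L, rfl⟩ := Quot.exists_rep g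
  have hrot : u ~r u' := isRotated_of_conj_positiveWord L u u' hg
  rcases hmin u' hrot with he | hlex
  · exact .inl he
  · exact .inr (.of_lex (by simpa using hrot.perm.length_eq) hlex)

end Retraction

/-- The right-angled Artin group of a complete graph is free abelian. -/
lemma isFreeAbelian_raag_of_forall_adj {V : Type*} (Γ : SimpleGraph V)
    (h : ∀ a b, a ≠ b → Γ.Adj a b) : IsFreeAbelian (RAAG Γ) := by
  have hcomm : ∀ a b : V, Commute (PresentedGroup.of (rels := raagRelators Γ) a)
      (PresentedGroup.of b) := by
    intro a b
    by_cases hab : a = b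
    · rw [hab]
    · have : PresentedGroup.mk (raagRelators Γ) _ = 1 :=
        PresentedGroup.one_of_mem ⟨a, b, h a b hab, rfl⟩
      simp only [map_mul, map_inv] at this
      exact mul_inv_eq_iff_eq_mul.1 (mul_inv_eq_one.1 this)
  have hcomm' : ∀ x y : RAAG Γ, x * y = y * x := by
    have hgen : ∀ (x : RAAG Γ) (s : Set (RAAG Γ)), (∀ y ∈ s, Commute x y) →
        Subgroup.closure s = ⊤ → ∀ y, Commute x y := by
      intro x s hs htop y
      have : Subgroup.closure s ≤ Subgroup.centralizer {x} := by
        rw [Subgroup.closure_le]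
        intro y hy
        exact Subgroup.mem_centralizer_singleton_iff.2 (hs y hy).eq.symm
      rw [htop] at this
      exact (Subgroup.mem_centralizer_singleton_iff.1 (this (Subgroup.mem_top y))).symm
    have htop := PresentedGroup.closure_range_of (raagRelators Γ)
    intro x
    refine hgen x _ ?_ htop
    rintro _ ⟨a, rfl⟩
    refine (hgen _ _ ?_ htop x).symm
    rintro _ ⟨b, rfl⟩
    exact hcomm a b
  let _ : CommGroup (RAAG Γ) := { (inferInstance : Group (RAAG Γ)) with mul_comm := hcomm' }
  let f : RAAG Γ →* Multiplicative (FreeAbelianGroup V) :=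
    PresentedGroup.toGroup (f := fun v ↦ Multiplicative.ofAdd (FreeAbelianGroup.of v)) <| by
      rintro _ ⟨a, b, -, rfl⟩
      simp
  let k : Multiplicative (FreeAbelianGroup V) →* RAAG Γ :=
    AddMonoidHom.toMultiplicativeLeft
      (FreeAbelianGroup.lift fun v ↦ Additive.ofMul (PresentedGroup.of v))
  refine ⟨V, ⟨MonoidHom.toMulEquiv f k ?_ ?_⟩⟩
  · ext v
    simp [f, k]
  · refine AddMonoidHom.toMultiplicative.symm.injective ?_
    ext v
    simp [f, k]

/-! ### The spherical conjugacy language -/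

theorem mainTheorem4 {V : Type*} [Finite V] (Γ : SimpleGraph V)
    (hΓ : ¬ IsFreeAbelian (RAAG Γ))
    (lt : V × Bool → V × Bool → Prop) [IsStrictTotalOrder (V × Bool) lt] :
    ¬ (conjSL (raagLetter Γ) lt).IsContextFree := by
  have hex : ∃ a b, lt (a, true) (b, true) ∧ ¬ Γ.Adj a b := by
    by_contra! hadj
    refine hΓ (isFreeAbelian_raag_of_forall_adj Γ fun a b hab ↦ ?_)
    rcases trichotomous_of lt (a, true) (b, true) with h | h | h
    · exact hadj a b h
    · exact absurd (congrArg Prod.fst h) hab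
    · exact (hadj b a h).symm
  obtain ⟨a, b, hlt, hab⟩ := hex
  refine not_isContextFree_of_four_runs_mem hlt (fun p s ↦ not_lex_rotation_of_mem_conjSL)
    fun n ↦ ?_
  set u := List.replicate n a ++ (List.replicate n b ++ (List.replicate n a ++ List.replicate n b))
    with hu
  have hword : positiveWord u = List.replicate n (a, true) ++ (List.replicate n (b, true) ++
      (List.replicate n (a, true) ++ List.replicate n (b, true))) := by
    simp [hu, positiveWord]
  rw [← hword]
  refine positiveWord_mem_conjSL hab lt (fun v hv ↦ ?_) fun u' hrot ↦ ?_
  · simp only [hu, List.mem_append, List.mem_replicate] at hv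
    tauto
  · obtain ⟨k, hk, rfl⟩ := List.isRotated_iff_mod.1 hrot
    have hsplit : positiveWord u = positiveWord (u.take k) ++ positiveWord (u.drop k) := by
      rw [positiveWord, positiveWord, ← List.map_append, List.take_append_drop]
    have hrot' : positiveWord (u.rotate k) =
        positiveWord (u.drop k) ++ positiveWord (u.take k) := by
      rw [List.rotate_eq_drop_append_take hk, positiveWord, List.map_append]
    rw [hrot', hsplit]
    exact four_runs_le_rotation hlt (hsplit.symm.trans hword)
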